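/- Let $q=p^m>2$, where $p$ is a prime and $m$ is a positive integer, and let $u$ be an integer with $2\le u\le\lfloor\frac{q+1}{2}\rfloor$. Let $\alpha$ be a primitive element of $\mathrm{GF}(q^2)$ and $\beta=\alpha^{q-1}$, a primitive $(q+1)$-th root of unity. Let $\mathbb{M}_{\beta^i}(x)$ denote the minimal polynomial of $\beta^i$ over $\mathrm{GF}(q)$, put $$g_u(x)=\mathbb{M}_{\beta^u}(x)\,\mathbb{M}_{\beta^{u+1}}(x)\cdots\mathbb{M}_{\beta^{\lfloor (q+1)/2\rfloor}}(x),$$ and let $\mathcal{C}_u$ be the cyclic code of length $q+1$ over $\mathrm{GF}(q)$ with generator polynomial $g_u(x)$, i.e. the set of all $(c_0,\ldots,c_q)\in\mathrm{GF}(q)^{q+1}$ such that the class of $\sum_i c_ix^i$ lies in the ideal $(g_u(x))$ of $\mathrm{GF}(q)[x]/(x^{q+1}-1)$. Let $$\overline{\mathcal{C}_u}=\Big\{(c_0,\ldots,c_{q+1})\in\mathrm{GF}(q)^{q+2}:(c_0,\ldots,c_q)\in\mathcal{C}_u,\ \sum_{i=0}^{q+1}c_i=0\Big\}$$ be its extended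 code, and let $(\overline{\mathcal{C}_u})^\perp$ be the dual of $\overline{\mathcal{C}_u}$ with respect to the standard bilinear form on $\mathrm{GF}(q)^{q+2}$. An $[n,k,d]$ code over $\mathrm{GF}(q)$ is a $k$-dimensional linear subspace of $\mathrm{GF}(q)^n$ with minimum Hamming distance $d$. Then the following hold. 1. If $u\mid(q+1)$, then $\overline{\mathcal{C}_u}$ has parameters $[q+2,\,2u-1,\,q-2u+3]$ and $(\overline{\mathcal{C}_u})^\perp$ has parameters $[q+2,\,q-2u+3,\,u+1]$. 2. If $u\nmid(q+1)$ and $(u+1)\mid(q+1)$, then $\overline{\mathcal{C}_u}$ has parameters $[q+2,\,2u-1,\,d]$, where $d=q-2u+4$ if $u=p=2$ and $m$ is odd, and $d=q-2u+3$ otherwise. The dual code $(\overline{\mathcal{C}_u})^\perp$ has parameters $[q+2,\,q-2u+3,\,u+2]$. -/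

import Mathlib

open Polynomial

namespace CodingTheory

/-- `C` is an `[n, k, d]` code over `F`: a `k`-dimensional linear subspace of `F ^ n` in which `d`
is the least Hamming distance between two distinct codewords. -/
structure IsCode {F : Type*} [Field F] [DecidableEq F] (n k d : ℕ)
    (C : Submodule F (Fin n → F)) : Prop where
  dim : Module.finrank F C = k
  dist : IsLeast {w : ℕ | ∃ a ∈ C, ∃ b ∈ C, a ≠ b ∧ hammingDist a b = w} d

/-- The dual code, with respect to the standard bilinear form `∑ i, c i * x i`. -/
def dualCode {F : Type*} [Field F] {n : ℕ} (C : Submodule F (Fin n → F)) :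
    Submodule F (Fin n → F) where
  carrier := {x | ∀ c ∈ C, ∑ i, c i * x i = 0}
  zero_mem' := by
    intro c _
    simp
  add_mem' := by
    intro x y hx hy c hc
    simp [mul_add, Finset.sum_add_distrib, hx c hc, hy c hc]
  smul_mem' := by
    intro a x hx c hc
    simp [mul_left_comm _ a, ← Finset.mul_sum, hx c hc]

/-- The extended code: all `(c_0, …, c_n)` with `(c_0, …, c_{n-1}) ∈ C` and `c_0 + ⋯ + c_n = 0`. -/
def extendedCode {F : Type*} [Field F] {n : ℕ} (C : Submodule F (Fin n → F)) :
    Submodule F (Fin (n + 1) → F) where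
  carrier := {c | (fun i : Fin n => c i.castSucc) ∈ C ∧ ∑ i, c i = 0}
  zero_mem' := ⟨C.zero_mem, by simp⟩
  add_mem' := by
    rintro x y ⟨hx, hx'⟩ ⟨hy, hy'⟩
    exact ⟨C.add_mem hx hy, by simp [Finset.sum_add_distrib, hx', hy']⟩
  smul_mem' := by
    rintro a x ⟨hx, hx'⟩
    exact ⟨C.smul_mem a hx, by simp [← Finset.mul_sum, hx']⟩

/-- The identification of `(c_0, …, c_{n-1})` with the class of `∑ i, c_i X ^ i` in
`F[X] / (X ^ n - 1)`. -/
noncomputable def toCyclic (F : Type*) [Field F] (n : ℕ) :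
    (Fin n → F) →ₗ[F] F[X] ⧸ Ideal.span {(X ^ n - 1 : F[X])} where
  toFun c := Ideal.Quotient.mk _ (∑ i : Fin n, C (c i) * X ^ (i : ℕ))
  map_add' x y := by
    rw [← map_add, ← Finset.sum_add_distrib]
    simp only [Pi.add_apply, map_add, add_mul]
  map_smul' a x := by
    have h : ∑ i : Fin n, C ((a • x) i) * X ^ (i : ℕ)
        = a • ∑ i : Fin n, C (x i) * X ^ (i : ℕ) := by
      simp only [Pi.smul_apply, smul_eq_mul, map_mul, mul_assoc, Finset.smul_sum, smul_eq_C_mul]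
    rw [h]
    rfl

/-- The cyclic code of length `n` that corresponds to the ideal `(g)` of `F[X] / (X ^ n - 1)`.
For a monic divisor `g` of `X ^ n - 1` this is the cyclic code with generator polynomial `g`. -/
noncomputable def cyclicCode {F : Type*} [Field F] (n : ℕ) (g : F[X]) :
    Submodule F (Fin n → F) :=
  ((Ideal.span {(Ideal.Quotient.mk (Ideal.span {(X ^ n - 1 : F[X])}) g)}).restrictScalars F).comap
    (toCyclic F n)

/-- The polynomial `g_u`: the product, over `u ≤ i ≤ ⌊(q + 1) / 2⌋`, of the minimal polynomials
of `β ^ i` over `F`. -/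
noncomputable def genPoly (F : Type*) {E : Type*} [Field F] [Field E] [Algebra F E]
    (q : ℕ) (β : E) (u : ℕ) : F[X] :=
  ∏ i ∈ Finset.Icc u ((q + 1) / 2), minpoly F (β ^ i)

/-- The code `C_u`: the cyclic code of length `q + 1` over `F` with generator polynomial `g_u`,
where `β = α ^ (q - 1)`. -/
noncomputable def classicalMDSCode (F : Type*) {E : Type*} [Field F] [Field E] [Algebra F E]
    (q : ℕ) (α : E) (u : ℕ) : Submodule F (Fin (q + 1) → F) :=
  cyclicCode (q + 1) (genPoly F q (α ^ (q - 1)) u)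

end CodingTheory

/-! Frobenius sends `β ^ j` to `β ^ (-j)`, so the words of `C_u` are exactly those vanishing at the
whole run `β ^ u, …, β ^ (q + 1 - u)`. The BCH bound then makes `C_u` an MDS code, and extension
preserves its dimension `2u - 1` and the lower bound on weights.

A word `x` of the dual of the extended code has vanishing power sums at the exponents `±1, …, ±(u -
1)`, while the one at `0` equals its last coordinate. If that coordinate is zero, BCH gives weight
at least `2u`. Otherwise the locator polynomial of the remaining support has degree at least `u`; if
the degree is `u`, it must be `X ^ u + const`, so the support is a coset of the `u`-th roots of
unity and `u ∣ q + 1` (`HasConsecutiveZeros.le_hammingNorm_dual`). Subgroups of order `u` or `u + 1`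
supply the extremal words (`HasConsecutiveZeros.exists_dual_of_dvd`).

The distance of the extended code follows by duality: a `k`-dimensional code has a nonzero word of
weight at most `n - k` iff its dual has one of weight at most `k`. -/

namespace CodingTheory

/-! ### Linear codes, duality and the Singleton bound -/

section LinearCodes

variable {F : Type*} [Field F] {n : ℕ}

theorem mem_dualCode {C : Submodule F (Fin n → F)} {x : Fin n → F} :
    x ∈ dualCode C ↔ ∀ c ∈ C, ∑ i, c i * x i = 0 := Iff.rfl

theorem finrank_dualCode (C : Submodule F (Fin n → F)) :
    Module.finrank F (dualCode C) = n - Module.finrank F C := by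
  have h : dualCode C = C.dualAnnihilator.comap
      (dotProductEquiv F (Fin n)).toLinearMap := by
    ext x
    simp only [mem_dualCode, Submodule.mem_comap, Submodule.mem_dualAnnihilator]
    refine forall₂_congr fun c _ => ?_
    simp [dotProduct, mul_comm]
  have h2 := Subspace.finrank_add_finrank_dualAnnihilator_eq C
  rw [Module.finrank_fin_fun] at h2
  rw [h, LinearEquiv.finrank_eq ((dotProductEquiv F (Fin n)).ofSubmodule' C.dualAnnihilator)]
  omega

/-- The restriction of the words of a code to a set of coordinates. -/
def restrictCoords (C : Submodule F (Fin n → F)) (T : Finset (Fin n)) : C →ₗ[F] (T → F) :=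
  (LinearMap.funLeft F F (fun i : T => (i : Fin n))).comp C.subtype

theorem restrictCoords_apply (C : Submodule F (Fin n → F)) (T : Finset (Fin n)) (c : C) (i : T) :
    restrictCoords C T c i = (c : Fin n → F) i := rfl

theorem injective_restrictCoords_iff (C : Submodule F (Fin n → F)) (T : Finset (Fin n))
    (h : Module.finrank F C = T.card) :
    Function.Injective (restrictCoords C T) ↔ Function.Surjective (restrictCoords C T) :=
  LinearMap.injective_iff_surjective_of_finrank_eq_finrank (by
    rw [h, Module.finrank_fintype_fun_eq_card, Fintype.card_coe])

variable [DecidableEq F]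

theorem hammingNorm_add_card_le (c : Fin n → F) (T : Finset (Fin n)) (h : ∀ i ∈ T, c i = 0) :
    hammingNorm c + T.card ≤ n := by
  have h1 : (Finset.univ.filter fun i => c i ≠ 0) ⊆ Tᶜ := by
    intro i hi
    rw [Finset.mem_compl]
    intro hT
    exact (Finset.mem_filter.1 hi).2 (h i hT)
  have h2 := Finset.card_le_card h1
  have h3 := Finset.card_add_card_compl T
  rw [Fintype.card_fin] at h3
  unfold hammingNorm
  omega

theorem exists_hammingNorm_le_of_not_injective (C : Submodule F (Fin n → F)) (T : Finset (Fin n))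
    (h : ¬ Function.Injective (restrictCoords C T)) :
    ∃ c ∈ C, c ≠ 0 ∧ hammingNorm c ≤ n - T.card := by
  rw [← LinearMap.ker_eq_bot, ← ne_eq, Submodule.ne_bot_iff] at h
  obtain ⟨c, hc, hc0⟩ := h
  refine ⟨c, c.2, by simpa using hc0, ?_⟩
  have := hammingNorm_add_card_le (c : Fin n → F) T fun i hi => by
    have := congrFun (LinearMap.mem_ker.1 hc) ⟨i, hi⟩
    simpa [restrictCoords_apply] using this
  omega

/-- The Singleton bound. -/
theorem exists_hammingNorm_le_singleton (C : Submodule F (Fin n → F)) {k : ℕ}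
    (hC : Module.finrank F C = k + 1) : ∃ c ∈ C, c ≠ 0 ∧ hammingNorm c ≤ n - k := by
  have hle : k ≤ n := by
    have := Submodule.finrank_le C
    rw [Module.finrank_fin_fun] at this
    omega
  obtain ⟨T, -, hT⟩ := Finset.exists_subset_card_eq (s := (Finset.univ : Finset (Fin n)))
    (n := k) (by simpa using hle)
  rw [← hT]
  refine exists_hammingNorm_le_of_not_injective C T fun h => ?_
  have := LinearMap.finrank_le_finrank_of_injective h
  rw [Module.finrank_fintype_fun_eq_card, Fintype.card_coe] at this
  omega

/-- A word of small weight in the dual code forces one in the code. -/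
theorem exists_hammingNorm_le_of_dual (C : Submodule F (Fin n → F)) {k : ℕ}
    (hC : Module.finrank F C = k) {x : Fin n → F} (hx : x ∈ dualCode C) (hx0 : x ≠ 0)
    (hxk : hammingNorm x ≤ k) : ∃ c ∈ C, c ≠ 0 ∧ hammingNorm c ≤ n - k := by
  have hle : k ≤ n := by
    have := Submodule.finrank_le C
    rw [Module.finrank_fin_fun] at this
    omega
  obtain ⟨T, hST, -, hT⟩ := Finset.exists_subsuperset_card_eq
    (Finset.subset_univ (Finset.univ.filter fun i => x i ≠ 0)) hxk (by simpa using hle)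
  rw [← hT]
  refine exists_hammingNorm_le_of_not_injective C T fun h => ?_
  -- If `T` were an information set, some codeword would restrict to a unit vector at `i ∈ T`;
  -- pairing it with `x`, supported in `T`, gives `x i ≠ 0`.
  rw [injective_restrictCoords_iff C T (by rw [hC, hT])] at h
  obtain ⟨i, hi⟩ := Function.ne_iff.1 hx0
  have hiT : i ∈ T := hST (by simpa using hi)
  obtain ⟨c, hc⟩ := h (Pi.single ⟨i, hiT⟩ 1)
  have hc' : ∀ j, c.1 j * x j = if j = i then x i else 0 := by
    intro j
    by_cases hj : j ∈ T
    · have := congrFun hc ⟨j, hj⟩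
      rw [restrictCoords_apply] at this
      simp only at this
      rw [this, Pi.single_apply]
      by_cases hji : j = i
      · subst hji; simp
      · simp [hji]
    · have hxj : x j = 0 := by
        by_contra h0
        exact hj (hST (by simpa using h0))
      have hji : j ≠ i := by rintro rfl; exact hj hiT
      simp [hxj, hji]
  have := hx c c.2
  simp only [hc', Finset.sum_ite_eq', Finset.mem_univ, if_true] at this
  exact hi this

/-- A word of small weight in the code forces one in the dual code. -/
theorem exists_dual_hammingNorm_le (C : Submodule F (Fin n → F)) {k : ℕ}
    (hC : Module.finrank F C = k) {c : Fin n → F} (hc : c ∈ C) (hc0 : c ≠ 0)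
    (hck : hammingNorm c + k ≤ n) : ∃ x ∈ dualCode C, x ≠ 0 ∧ hammingNorm x ≤ k := by
  have hcard : k ≤ (Finset.univ.filter fun i => c i = 0).card := by
    have := Finset.card_filter_add_card_filter_not (s := (Finset.univ : Finset (Fin n)))
      (fun i => c i = 0)
    rw [Finset.card_univ, Fintype.card_fin] at this
    unfold hammingNorm at hck
    simp only [ne_eq] at hck
    omega
  obtain ⟨T, hTs, hT⟩ := Finset.exists_subset_card_eq hcard
  have hinj : ¬ Function.Injective (restrictCoords C T) := by
    intro h
    apply hc0
    have : (⟨c, hc⟩ : C) = 0 := h (by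
      ext i
      rw [map_zero, restrictCoords_apply]
      exact (Finset.mem_filter.1 (hTs i.2)).2)
    exact congrArg Subtype.val this
  rw [injective_restrictCoords_iff C T (by rw [hC, hT]), ← LinearMap.range_eq_top] at hinj
  -- A nonzero functional on `T → F` killing the restricted code becomes, extended by zero, the dual
  -- word.
  obtain ⟨f, hf0, hf⟩ := Submodule.exists_le_ker_of_lt_top _ (lt_top_iff_ne_top.2 hinj)
  set x : Fin n → F := fun i => if h : i ∈ T then f (Pi.single ⟨i, h⟩ 1) else 0 with hx
  have hsum : ∀ w : Fin n → F, ∑ i, w i * x i = f fun i : T => w i := by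
    intro w
    rw [LinearMap.pi_apply_eq_sum_univ f]
    rw [← Finset.sum_subset (Finset.subset_univ T) (by intro i _ hi; simp [hx, hi]),
      ← Finset.sum_coe_sort T]
    refine Finset.sum_congr rfl fun i _ => ?_
    simp only [hx, i.2, dif_pos, smul_eq_mul]
    congr 2
    ext j
    simp [Pi.single_apply, eq_comm]
  refine ⟨x, fun w hw => ?_, fun h0 => hf0 ?_, ?_⟩
  · rw [hsum]
    exact hf ⟨⟨w, hw⟩, rfl⟩
  · refine LinearMap.pi_ext' fun i => LinearMap.ext_ring ?_
    have := congrFun h0 i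
    simpa [hx] using this
  · rw [← hT]
    refine Finset.card_le_card fun i hi => ?_
    by_contra h
    exact (Finset.mem_filter.1 hi).2 (by simp [hx, h])

theorem isCode_of {k d : ℕ} {C : Submodule F (Fin n → F)} (hk : Module.finrank F C = k)
    (hex : ∃ c ∈ C, c ≠ 0 ∧ hammingNorm c ≤ d) (hle : ∀ c ∈ C, c ≠ 0 → d ≤ hammingNorm c) :
    IsCode n k d C where
  dim := hk
  dist := by
    obtain ⟨c, hc, hc0, hcd⟩ := hex
    refine ⟨⟨c, hc, 0, C.zero_mem, hc0, ?_⟩, ?_⟩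
    · rw [hammingDist_zero_right]
      exact le_antisymm hcd (hle c hc hc0)
    · rintro w ⟨a, ha, b, hb, hab, rfl⟩
      rw [hammingDist_eq_hammingNorm]
      exact hle _ (C.add_mem (C.neg_mem ha) hb) fun h => hab (neg_add_eq_zero.1 h)

end LinearCodes

/-! ### The parity-check extension -/

section Extension

variable {F : Type*} [Field F] {n : ℕ}

theorem mem_extendedCode {C : Submodule F (Fin n → F)} {c : Fin (n + 1) → F} :
    c ∈ extendedCode C ↔
      (fun i : Fin n => c i.castSucc) ∈ C ∧ ∑ i : Fin n, c i.castSucc + c (Fin.last n) = 0 := by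
  rw [← Fin.sum_univ_castSucc]
  rfl

theorem finrank_extendedCode (C : Submodule F (Fin n → F)) :
    Module.finrank F (extendedCode C) = Module.finrank F C := by
  let f : extendedCode C →ₗ[F] C :=
    ((LinearMap.funLeft F F (Fin.castSucc : Fin n → Fin (n + 1))).comp
      (extendedCode C).subtype).codRestrict C fun c => (mem_extendedCode.1 c.2).1
  have hf : ∀ (c : extendedCode C) (i : Fin n), (f c : Fin n → F) i = c.1 i.castSucc :=
    fun _ _ => rfl
  refine (LinearEquiv.ofBijective f ⟨?_, ?_⟩).finrank_eq
  · rw [← LinearMap.ker_eq_bot, LinearMap.ker_eq_bot']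
    intro c hc
    have h0 : ∀ i : Fin n, c.1 i.castSucc = 0 := fun i => by rw [← hf, hc]; rfl
    have h1 := (mem_extendedCode.1 c.2).2
    simp only [h0, Finset.sum_const_zero, zero_add] at h1
    ext i
    refine Fin.lastCases ?_ ?_ i
    · simpa using h1
    · simpa using h0
  · intro c
    refine ⟨⟨Fin.snoc (α := fun _ => F) c.1 (-∑ i, c.1 i), mem_extendedCode.2 ?_⟩, ?_⟩
    · simp
    · ext i
      rw [hf]
      simp

theorem hammingNorm_fin_succ [DecidableEq F] (c : Fin (n + 1) → F) :
    hammingNorm c = hammingNorm (fun i : Fin n => c i.castSucc) +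
      if c (Fin.last n) = 0 then 0 else 1 := by
  unfold hammingNorm
  rw [Finset.card_filter, Finset.card_filter, Fin.sum_univ_castSucc]
  congr 1
  split_ifs <;> simp_all

end Extension

/-! ### Power sums and the BCH bound -/

section PowerSums

variable {E : Type*} [Field E] {n : ℕ} {b : E}

theorem sum_pow_mul_of_isPrimitiveRoot (hb : IsPrimitiveRoot b n) (i : ℕ) :
    ∑ k : Fin n, b ^ (i * k) = if n ∣ i then (n : E) else 0 := by
  have h : ∑ k : Fin n, b ^ (i * k) = ∑ k ∈ Finset.range n, (b ^ i) ^ k := by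
    rw [Finset.sum_range]
    simp only [pow_mul]
  rw [h]
  split_ifs with hi
  · simp [hb.pow_eq_one_iff_dvd i |>.2 hi]
  · have h1 : b ^ i ≠ 1 := fun h1 => hi ((hb.pow_eq_one_iff_dvd i).1 h1)
    rw [geom_sum_eq h1, ← pow_mul, mul_comm, pow_mul, hb.pow_eq_one, one_pow, sub_self, zero_div]

theorem sum_mul_eval_eq (w : Fin n → E) (v : ℕ) (P : E[X]) {r : ℕ} (hr : P.natDegree < r) :
    ∑ k : Fin n, w k * b ^ (v * k) * P.eval (b ^ (k : ℕ)) =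
      ∑ j ∈ Finset.range r, P.coeff j * ∑ k : Fin n, w k * b ^ ((v + j) * k) := by
  simp only [eval_eq_sum_range' hr, Finset.mul_sum]
  rw [Finset.sum_comm]
  refine Finset.sum_congr rfl fun j _ => Finset.sum_congr rfl fun k _ => ?_
  ring

theorem eval_prod_X_sub_C_eq_zero_iff (hb : IsPrimitiveRoot b n) (S : Finset (Fin n)) (k : Fin n) :
    (∏ i ∈ S, (X - C (b ^ (i : ℕ)))).eval (b ^ (k : ℕ)) = 0 ↔ k ∈ S := by
  rw [eval_prod, Finset.prod_eq_zero_iff]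
  simp only [eval_sub, eval_X, eval_C, sub_eq_zero]
  constructor
  · rintro ⟨i, hi, h⟩
    rwa [Fin.ext (hb.pow_inj k.2 i.2 h)]
  · exact fun h => ⟨k, h, rfl⟩

/-- The BCH bound. -/
theorem lt_hammingNorm_of_power_sums_eq_zero [DecidableEq E] (hb : IsPrimitiveRoot b n)
    {w : Fin n → E} (hw : w ≠ 0) {v r : ℕ}
    (h : ∀ j < r, ∑ k : Fin n, w k * b ^ ((v + j) * k) = 0) : r < hammingNorm w := by
  by_contra! hr
  obtain ⟨k₀, hk₀⟩ := Function.ne_iff.1 hw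
  have hn : n ≠ 0 := by rintro rfl; exact k₀.elim0
  set S : Finset (Fin n) := Finset.univ.filter fun k => w k ≠ 0 with hS
  have hk₀S : k₀ ∈ S := by simpa [hS] using hk₀
  have hcard : S.card ≤ r := hr
  -- Weighting by this polynomial isolates the term at `k₀`, yet its degree is small enough that the
  -- sum combines vanishing power sums only.
  set P : E[X] := ∏ i ∈ S.erase k₀, (X - C (b ^ (i : ℕ))) with hP
  have hdeg : P.natDegree < r := by
    rw [hP, natDegree_finsetProd_X_sub_C_eq_card, Finset.card_erase_of_mem hk₀S]
    have := Finset.card_pos.2 ⟨_, hk₀S⟩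
    omega
  have h1 := sum_mul_eval_eq (b := b) w v P hdeg
  rw [Finset.sum_eq_zero (s := Finset.range r) fun j hj => by
    rw [h j (Finset.mem_range.1 hj), mul_zero], Finset.sum_eq_single k₀] at h1
  · rw [mul_eq_zero, mul_eq_zero, hP, eval_prod_X_sub_C_eq_zero_iff hb] at h1
    rcases h1 with (h1 | h1) | h1
    · exact hk₀ h1
    · exact pow_ne_zero _ (hb.ne_zero hn) h1
    · simp at h1
  · intro k _ hk
    by_cases hkS : k ∈ S
    · rw [hP, (eval_prod_X_sub_C_eq_zero_iff hb _ _).2 (Finset.mem_erase.2 ⟨hk, hkS⟩), mul_zero]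
    · have : w k = 0 := by simpa [hS] using hkS
      rw [this, zero_mul, zero_mul]
  · simp

end PowerSums

/-! ### Frobenius and trace for the quadratic extension -/

section FiniteFields

variable {F E : Type*} [Field F] [Fintype F] [Field E] [Algebra F E] {q : ℕ}

theorem exists_algebraMap_eq_of_pow_eq (hF : Fintype.card F = q) {t : E} (ht : t ^ q = t) :
    ∃ s : F, algebraMap F E s = t := by
  classical
  by_contra! h
  have hq : 1 < q := hF ▸ Fintype.one_lt_card
  set S : Finset E := insert t (Finset.univ.image (algebraMap F E)) with hS
  have hcard : S.card = q + 1 := by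
    rw [hS, Finset.card_insert_of_notMem (by simpa using h),
      Finset.card_image_of_injective _ (algebraMap F E).injective, Finset.card_univ, hF]
  have hsub : S.val ⊆ (X ^ q - X : E[X]).roots := by
    intro x hx
    rw [mem_roots (FiniteField.X_pow_card_sub_X_ne_zero E hq), IsRoot.def, eval_sub, eval_pow,
      eval_X, sub_eq_zero]
    rcases Finset.mem_insert.1 (show x ∈ S from hx) with rfl | hx
    · exact ht
    · obtain ⟨s, -, rfl⟩ := Finset.mem_image.1 hx
      rw [← map_pow, ← hF, FiniteField.pow_card]
  have := card_le_degree_of_subset_roots hsub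
  rw [FiniteField.X_pow_card_sub_X_natDegree_eq E hq] at this
  omega

theorem add_pow_card_eq (hF : Fintype.card F = q) (x y : E) : (x + y) ^ q = x ^ q + y ^ q := by
  subst hF
  exact map_add (FiniteField.frobeniusAlgHom F E) x y

theorem cast_card_eq_zero_of_algebra (hF : Fintype.card F = q) : (q : E) = 0 := by
  rw [← hF, ← map_natCast (algebraMap F E), FiniteField.cast_card_eq_zero, map_zero]

variable [Fintype E]

theorem exists_algebraMap_eq_add_pow (hF : Fintype.card F = q) (hE : Fintype.card E = q ^ 2)
    (y : E) : ∃ s : F, algebraMap F E s = y + y ^ q := by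
  apply exists_algebraMap_eq_of_pow_eq hF
  rw [add_pow_card_eq hF, ← pow_mul, ← pow_two, ← hE, FiniteField.pow_card, add_comm]

end FiniteFields

theorem pow_mul_eq_pow_sub {E : Type*} [Field E] {q : ℕ} {b : E} (hb : IsPrimitiveRoot b (q + 1))
    {j : ℕ} (hj : j ≤ q + 1) : b ^ (q * j) = b ^ (q + 1 - j) := by
  refine mul_right_cancel₀ (pow_ne_zero j (hb.ne_zero (Nat.succ_ne_zero q))) ?_
  rw [← pow_add, ← pow_add, Nat.sub_add_cancel hj, hb.pow_eq_one, ← Nat.succ_mul, pow_mul,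
    Nat.succ_eq_add_one, hb.pow_eq_one, one_pow]

/-! ### Weights in the extended code and its dual -/

section ConsecutiveZeros

variable {F E : Type*} [Field F] [Field E] [Algebra F E] {q u : ℕ} {b : E}

/-- The words of `C` are those whose polynomial vanishes at `b ^ u, …, b ^ (q + 1 - u)`. -/
def HasConsecutiveZeros (C : Submodule F (Fin (q + 1) → F)) (b : E) (u : ℕ) : Prop :=
  ∀ c, c ∈ C ↔ ∀ j, u ≤ j → j ≤ q + 1 - u →
    ∑ k : Fin (q + 1), algebraMap F E (c k) * b ^ (j * k) = 0

theorem HasConsecutiveZeros.le_hammingNorm [DecidableEq F] {C : Submodule F (Fin (q + 1) → F)}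
    (hC : HasConsecutiveZeros C b u) (hb : IsPrimitiveRoot b (q + 1)) (hu : 2 * u ≤ q + 1)
    {c : Fin (q + 1) → F} (hc : c ∈ C) (hc0 : c ≠ 0) : q + 3 - 2 * u ≤ hammingNorm c := by
  classical
  have hinj := (algebraMap F E).injective
  have h := lt_hammingNorm_of_power_sums_eq_zero hb (w := fun k => algebraMap F E (c k)) (v := u)
    (r := q + 2 - 2 * u) (by
      obtain ⟨k, hk⟩ := Function.ne_iff.1 hc0
      exact Function.ne_iff.2 ⟨k, by simpa using hk⟩)
    fun j hj => (hC c).1 hc _ (by omega) (by omega)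
  rw [hammingNorm_comp (fun _ => algebraMap F E) (fun _ => hinj) fun _ => map_zero _] at h
  omega

theorem HasConsecutiveZeros.le_hammingNorm_extendedCode [DecidableEq F]
    {C : Submodule F (Fin (q + 1) → F)} (hC : HasConsecutiveZeros C b u)
    (hb : IsPrimitiveRoot b (q + 1)) (hu : 2 * u ≤ q + 1)
    {c : Fin (q + 1 + 1) → F} (hc : c ∈ extendedCode C) (hc0 : c ≠ 0) :
    q + 3 - 2 * u ≤ hammingNorm c := by
  rw [mem_extendedCode] at hc
  rw [hammingNorm_fin_succ]
  refine le_add_right (hC.le_hammingNorm hb hu hc.1 fun h => hc0 ?_)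
  have h0 : ∀ i : Fin (q + 1), c i.castSucc = 0 := fun i => congrFun h i
  have h1 := hc.2
  simp only [h0, Finset.sum_const_zero, zero_add] at h1
  ext i
  exact Fin.lastCases h1 h0 i

/-- The word supported on the subgroup of order `v` and on the last coordinate. -/
theorem HasConsecutiveZeros.exists_dual_of_dvd [DecidableEq F] {C : Submodule F (Fin (q + 1) → F)}
    (hC : HasConsecutiveZeros C b u) (hb : IsPrimitiveRoot b (q + 1)) (hq : (q : E) = 0)
    {v : ℕ} (hv : v ∣ q + 1) (huv : u ≤ v) :
    ∃ x ∈ dualCode (extendedCode C), x ≠ 0 ∧ hammingNorm x ≤ v + 1 := by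
  obtain ⟨r, hr⟩ := hv
  have hr0 : 0 < r := Nat.pos_of_ne_zero (by rintro rfl; omega)
  have hv0 : 0 < v := Nat.pos_of_ne_zero (by rintro rfl; omega)
  have hbv : IsPrimitiveRoot (b ^ v) r := hb.pow (Nat.succ_pos q) hr
  have hvr : (v : E) * r = 1 := by
    rw [← Nat.cast_mul, ← hr, Nat.cast_succ, hq, zero_add]
  have hsum : ∀ k : ℕ, ∑ l : Fin r, b ^ (v * l * k) = if r ∣ k then (r : E) else 0 := by
    intro k
    rw [← sum_pow_mul_of_isPrimitiveRoot hbv k]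
    refine Finset.sum_congr rfl fun l _ => ?_
    rw [← pow_mul]
    ring_nf
  -- The last coordinate is `v = 1 / r`, because `v * r = q + 1 = 1` in `E`. The indicator of `r ∣
  -- k` is `1 / r` times a sum of the characters with exponents `v * l`; those with `l ≠ 0` fall in
  -- the run of zeros.
  refine ⟨Fin.snoc (α := fun _ => F) (fun k : Fin (q + 1) => if r ∣ (k : ℕ) then 1 else 0) v,
    fun c hc => ?_, fun h => ?_, ?_⟩
  · rw [mem_extendedCode] at hc
    obtain ⟨hc, hlast⟩ := hc
    rw [Fin.sum_univ_castSucc]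
    simp only [Fin.snoc_castSucc, Fin.snoc_last]
    apply (algebraMap F E).injective
    have hS : ∑ k : Fin (q + 1), algebraMap F E (c k.castSucc) * (if r ∣ (k : ℕ) then (r : E) else 0)
        = ∑ k : Fin (q + 1), algebraMap F E (c k.castSucc) := by
      simp only [← hsum, Finset.mul_sum]
      rw [Finset.sum_comm, Finset.sum_eq_single ⟨0, hr0⟩]
      · simp
      · intro l _ hl
        have hl0 : 1 ≤ (l : ℕ) := Nat.one_le_iff_ne_zero.2 fun h => hl (Fin.ext h)
        refine (hC _).1 hc _ (huv.trans (Nat.le_mul_of_pos_right v hl0)) ?_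
        have : v * (l + 1) ≤ v * r := Nat.mul_le_mul_left v l.2
        rw [mul_add] at this
        omega
      · simp
    have hlast' := congrArg (algebraMap F E) hlast
    rw [map_add, map_sum, map_zero] at hlast'
    rw [map_add, map_sum, map_zero, map_mul, map_natCast]
    have h2 : ∑ k : Fin (q + 1), algebraMap F E (c k.castSucc * if r ∣ (k : ℕ) then 1 else 0) =
        v * ∑ k : Fin (q + 1), algebraMap F E (c k.castSucc) := by
      rw [← hS, Finset.mul_sum]
      refine Finset.sum_congr rfl fun k _ => ?_
      split_ifs
      · rw [mul_one, mul_left_comm, hvr, mul_one]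
      · simp
    rw [h2, mul_comm _ (v : E), ← mul_add, hlast', mul_zero]
  · have := congrFun h (0 : Fin (q + 1)).castSucc
    rw [Fin.snoc_castSucc] at this
    simp at this
  · rw [hammingNorm_fin_succ]
    simp only [Fin.snoc_castSucc, Fin.snoc_last]
    refine add_le_add ?_ (by split_ifs <;> simp)
    have hsub : (Finset.univ.filter fun k : Fin (q + 1) =>
        (if r ∣ (k : ℕ) then (1 : F) else 0) ≠ 0).map Fin.valEmbedding ⊆
        (Finset.range v).image (r * ·) := by
      intro k hk
      simp only [Finset.mem_map, Finset.mem_filter, Finset.mem_univ, true_and, ne_eq,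
        ite_eq_right_iff, one_ne_zero, imp_false, not_not, Fin.valEmbedding_apply] at hk
      obtain ⟨a, ⟨l, hl⟩, rfl⟩ := hk
      refine Finset.mem_image.2 ⟨l, Finset.mem_range.2 ?_, hl.symm⟩
      have := a.2
      rw [hl, hr, mul_comm v] at this
      exact lt_of_mul_lt_mul_left this (Nat.zero_le r)
    have := (Finset.card_le_card hsub).trans Finset.card_image_le
    rwa [Finset.card_map, Finset.card_range] at this

/-- If all points of a set of `u` many `n`-th roots of unity have the same `u`-th power, then `u`
divides `n`. -/
theorem card_dvd_of_pow_card_eq {n : ℕ} (hb : IsPrimitiveRoot b n) {S : Finset (Fin n)}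
    (hS : S.Nonempty) {a : E} (h : ∀ k ∈ S, (b ^ (k : ℕ)) ^ S.card = a) : S.card ∣ n := by
  classical
  obtain ⟨k₀, hk₀⟩ := hS
  have hn : n ≠ 0 := by rintro rfl; exact k₀.elim0
  have hb0 : b ≠ 0 := hb.ne_zero hn
  -- Ratios of the points are both `S.card`-th and `n`-th roots of unity, hence `g`-th ones. There
  -- are at most `g` of those, which forces `g = S.card`.
  set g := Nat.gcd S.card n with hg
  have hgpos : 0 < g := Nat.gcd_pos_of_pos_right _ (Nat.pos_of_ne_zero hn)
  have hsub : S.image (fun k : Fin n => b ^ (k : ℕ)) ⊆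
      (nthRoots g ((b ^ (k₀ : ℕ)) ^ g)).toFinset := by
    intro y hy
    obtain ⟨k, hk, rfl⟩ := Finset.mem_image.1 hy
    rw [Multiset.mem_toFinset, mem_nthRoots hgpos]
    have h0 : b ^ (k₀ : ℕ) ≠ 0 := pow_ne_zero _ hb0
    have hbn : ∀ i : ℕ, (b ^ i) ^ n = 1 := fun i => by
      rw [← pow_mul, mul_comm, pow_mul, hb.pow_eq_one, one_pow]
    have h1 : (b ^ (k : ℕ) / b ^ (k₀ : ℕ)) ^ g = 1 := by
      refine pow_gcd_eq_one.2 ⟨?_, ?_⟩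
      · rw [div_pow, h k hk, h k₀ hk₀, div_self]
        rw [← h k₀ hk₀]
        exact pow_ne_zero _ h0
      · rw [div_pow, hbn, hbn, div_one]
    rwa [div_pow, div_eq_one_iff_eq (pow_ne_zero _ h0)] at h1
  have hle := (Finset.card_le_card hsub).trans
    ((Multiset.toFinset_card_le _).trans (card_nthRoots _ _))
  rw [Finset.card_image_of_injective _ fun i j hij => Fin.ext (hb.pow_inj i.2 j.2 hij)] at hle
  have : g = S.card := le_antisymm
    (Nat.le_of_dvd (Finset.card_pos.2 ⟨_, hk₀⟩) (Nat.gcd_dvd_left _ _)) hle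
  rw [← this]
  exact Nat.gcd_dvd_right _ _

variable [Fintype F]

/-- Pair with the extended all-ones word, whose last entry is `-1` because `q + 1 = 1` in `F`. -/
theorem HasConsecutiveZeros.dual_sum {C : Submodule F (Fin (q + 1) → F)}
    (hC : HasConsecutiveZeros C b u) (hb : IsPrimitiveRoot b (q + 1)) (hu1 : 1 ≤ u)
    (hF : Fintype.card F = q) {x : Fin (q + 1 + 1) → F} (hx : x ∈ dualCode (extendedCode C)) :
    ∑ k : Fin (q + 1), x k.castSucc = x (Fin.last (q + 1)) := by
  have hqF : (q : F) = 0 := by rw [← hF, FiniteField.cast_card_eq_zero]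
  have hc := hx (Fin.snoc (α := fun _ => F) (fun _ : Fin (q + 1) => 1) (-1))
      (mem_extendedCode.2 ⟨?_, ?_⟩)
  · rw [Fin.sum_univ_castSucc] at hc
    simp only [Fin.snoc_castSucc, Fin.snoc_last, one_mul] at hc
    linear_combination hc
  · simp only [Fin.snoc_castSucc]
    refine (hC _).2 fun i hi hi' => ?_
    simp only [map_one, one_mul]
    rw [sum_pow_mul_of_isPrimitiveRoot hb, if_neg]
    intro h
    have := Nat.le_of_dvd (by omega) h
    omega
  · simp [hqF]

variable [Fintype E]

/-- The trace words `k ↦ Tr (a * b ^ (j * k))` lie in `C` and have zero sum. Pairing with them gives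
one linear relation between the two power sums for each `a`, and `a = 1`, `a = b` already separate
them. -/
theorem HasConsecutiveZeros.dual_power_sums {C : Submodule F (Fin (q + 1) → F)}
    (hC : HasConsecutiveZeros C b u) (hb : IsPrimitiveRoot b (q + 1)) (hq2 : 2 < q)
    (hu : 2 * u ≤ q + 1) (hF : Fintype.card F = q) (hE : Fintype.card E = q ^ 2)
    {x : Fin (q + 1 + 1) → F} (hx : x ∈ dualCode (extendedCode C)) {j : ℕ} (hj : 1 ≤ j)
    (hju : j < u) :
    ∑ k : Fin (q + 1), algebraMap F E (x k.castSucc) * b ^ (j * k) = 0 ∧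
      ∑ k : Fin (q + 1), algebraMap F E (x k.castSucc) * b ^ ((q + 1 - j) * k) = 0 := by
  have key : ∀ a : E,
      a * ∑ k : Fin (q + 1), algebraMap F E (x k.castSucc) * b ^ (j * k) +
        a ^ q * ∑ k : Fin (q + 1), algebraMap F E (x k.castSucc) * b ^ ((q + 1 - j) * k) = 0 := by
    intro a
    choose f hf using exists_algebraMap_eq_add_pow (F := F) (E := E) hF hE
    have hy : ∀ k : ℕ, algebraMap F E (f (a * b ^ (j * k))) =
        a * b ^ (j * k) + a ^ q * b ^ ((q + 1 - j) * k) := by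
      intro k
      rw [hf, mul_pow, pow_mul b (q + 1 - j), ← pow_mul_eq_pow_sub hb (by omega), ← pow_mul,
        ← pow_mul]
      ring_nf
    have hsum : ∀ i, i + j < q + 1 → j ≠ i →
        ∑ k : Fin (q + 1), algebraMap F E (f (a * b ^ (j * (k : ℕ)))) * b ^ (i * k) = 0 := by
      intro i hij hne
      have h : ∀ k : ℕ, algebraMap F E (f (a * b ^ (j * k))) * b ^ (i * k) =
          a * b ^ ((j + i) * k) + a ^ q * b ^ ((q + 1 - j + i) * k) := by
        intro k
        rw [hy]
        ring
      simp only [h]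
      rw [Finset.sum_add_distrib, ← Finset.mul_sum, ← Finset.mul_sum,
        sum_pow_mul_of_isPrimitiveRoot hb, sum_pow_mul_of_isPrimitiveRoot hb, if_neg, if_neg,
        mul_zero, mul_zero, add_zero]
      · rintro ⟨l, hl⟩
        have h1 : l < 2 := by
          by_contra! h2
          have := Nat.mul_le_mul_left (q + 1) h2
          omega
        interval_cases l <;> omega
      · intro h
        have := Nat.le_of_dvd (by omega) h
        omega
    have hc := hx (Fin.snoc (α := fun _ => F) (fun k : Fin (q + 1) => f (a * b ^ (j * (k : ℕ)))) 0)
      (mem_extendedCode.2 ⟨?_, ?_⟩)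
    · rw [Fin.sum_univ_castSucc] at hc
      simp only [Fin.snoc_castSucc, Fin.snoc_last, zero_mul, add_zero] at hc
      have hc' := congrArg (algebraMap F E) hc
      simp only [map_sum, map_mul, map_zero, hy] at hc'
      rw [Finset.mul_sum, Finset.mul_sum, ← Finset.sum_add_distrib, ← hc']
      refine Finset.sum_congr rfl fun k _ => ?_
      ring
    · simp only [Fin.snoc_castSucc]
      exact (hC _).2 fun i hi hi' => hsum i (by omega) (by omega)
    · simp only [Fin.snoc_castSucc, Fin.snoc_last, add_zero]
      apply (algebraMap F E).injective
      rw [map_sum, map_zero, ← hsum 0 (by omega) (by omega)]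
      simp
  set A := ∑ k : Fin (q + 1), algebraMap F E (x k.castSucc) * b ^ (j * k)
  set B := ∑ k : Fin (q + 1), algebraMap F E (x k.castSucc) * b ^ ((q + 1 - j) * k)
  have h1 := key 1
  have h2 := key b
  rw [one_pow, one_mul, one_mul] at h1
  have hbq : b - b ^ q ≠ 0 := by
    rw [sub_ne_zero]
    intro h
    have := hb.pow_inj (i := 1) (j := q) (by omega) (by omega) (by simpa using h)
    omega
  have hA : A = 0 := by
    have : (b - b ^ q) * A = 0 := by linear_combination h2 - b ^ q * h1
    exact (mul_eq_zero.1 this).resolve_left hbq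
  exact ⟨hA, by rwa [hA, zero_add] at h1⟩

/-- The power sums of a dual word over a window of `2 u - 1` consecutive exponents. -/
theorem HasConsecutiveZeros.dual_window {C : Submodule F (Fin (q + 1) → F)}
    (hC : HasConsecutiveZeros C b u) (hb : IsPrimitiveRoot b (q + 1)) (hq2 : 2 < q)
    (hu1 : 1 ≤ u) (hu : 2 * u ≤ q + 1) (hF : Fintype.card F = q) (hE : Fintype.card E = q ^ 2)
    {x : Fin (q + 1 + 1) → F} (hx : x ∈ dualCode (extendedCode C)) {j : ℕ}
    (hj : q + 1 < j + u) (hju : j < q + 1 + u) :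
    ∑ k : Fin (q + 1), algebraMap F E (x k.castSucc) * b ^ (j * k) =
      if j = q + 1 then algebraMap F E (x (Fin.last (q + 1))) else 0 := by
  -- Centring the window at `q + 1` instead of `0` avoids negative exponents.
  have hper : ∀ i k : ℕ, b ^ ((q + 1 + i) * k) = b ^ (i * k) := by
    intro i k
    rw [add_mul, pow_add, pow_mul, hb.pow_eq_one, one_pow, one_mul]
  rcases lt_trichotomy j (q + 1) with h | rfl | h
  · rw [if_neg h.ne]
    have := (hC.dual_power_sums hb hq2 hu hF hE hx (j := q + 1 - j) (by omega) (by omega)).2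
    rwa [Nat.sub_sub_self h.le] at this
  · rw [if_pos rfl, ← hC.dual_sum hb hu1 hF hx, map_sum]
    refine Finset.sum_congr rfl fun k _ => ?_
    have := hper 0 k
    rw [add_zero, zero_mul, pow_zero] at this
    rw [this, mul_one]
  · rw [if_neg h.ne']
    obtain ⟨i, rfl⟩ := Nat.exists_eq_add_of_lt h
    simp only [add_assoc (q + 1), hper]
    exact (hC.dual_power_sums hb hq2 hu hF hE hx (j := i + 1) (by omega) (by omega)).1

theorem HasConsecutiveZeros.le_hammingNorm_dual [DecidableEq F]
    {C : Submodule F (Fin (q + 1) → F)}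
    (hC : HasConsecutiveZeros C b u) (hb : IsPrimitiveRoot b (q + 1)) (hq2 : 2 < q)
    (hu2 : 2 ≤ u) (hu : 2 * u ≤ q + 1) (hF : Fintype.card F = q) (hE : Fintype.card E = q ^ 2)
    {x : Fin (q + 1 + 1) → F} (hx : x ∈ dualCode (extendedCode C)) (hx0 : x ≠ 0) :
    u + 1 ≤ hammingNorm x ∧ (¬ u ∣ q + 1 → u + 2 ≤ hammingNorm x) := by
  classical
  have hinj := (algebraMap F E).injective
  have hwin := fun j => hC.dual_window hb hq2 (by omega) hu hF hE hx (j := j)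
  rw [hammingNorm_fin_succ]
  set w : Fin (q + 1) → F := fun k => x k.castSucc with hw
  by_cases hlast : x (Fin.last (q + 1)) = 0
  · have hw0 : w ≠ 0 := by
      intro h
      apply hx0
      ext i
      exact Fin.lastCases hlast (fun i => congrFun h i) i
    have h := lt_hammingNorm_of_power_sums_eq_zero hb (w := fun k => algebraMap F E (w k))
      (v := q + 2 - u) (r := 2 * u - 1) (by
        obtain ⟨k, hk⟩ := Function.ne_iff.1 hw0
        exact Function.ne_iff.2 ⟨k, by simpa using hk⟩)
      fun j hj => by
        rw [hwin _ (by omega) (by omega), hlast, map_zero, ite_self]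
    rw [hammingNorm_comp (fun _ => algebraMap F E) (fun _ => hinj) fun _ => map_zero _] at h
    omega
  · rw [if_neg hlast]
    set S : Finset (Fin (q + 1)) := Finset.univ.filter fun k => w k ≠ 0 with hS
    have hnorm : hammingNorm w = S.card := rfl
    set P : E[X] := ∏ i ∈ S, (X - Polynomial.C (b ^ (i : ℕ))) with hP
    have hdeg : P.natDegree = S.card := natDegree_finsetProd_X_sub_C_eq_card _ _
    have hroot : ∀ k ∈ S, P.eval (b ^ (k : ℕ)) = 0 := fun k hk =>
      (eval_prod_X_sub_C_eq_zero_iff hb S k).2 hk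
    -- Start the exponents at `q + 1 - i`: every power sum met stays in the window, and only the
    -- `i`-th coefficient meets the nonzero one, at `q + 1`.
    have hcoeff : ∀ i < u, S.card < i + u → P.coeff i = 0 := by
      intro i hi hiS
      have h := sum_mul_eval_eq (b := b) (fun k => algebraMap F E (w k)) (q + 1 - i) P
        (r := i + u) (by omega)
      rw [Finset.sum_eq_zero, Finset.sum_eq_single i] at h
      · rw [hwin _ (by omega) (by omega), if_pos (by omega)] at h
        exact (mul_eq_zero.1 h.symm).resolve_right (by simpa using hlast)
      · intro j hj hji
        rw [Finset.mem_range] at hj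
        rw [hwin _ (by omega) (by omega), if_neg (by omega), mul_zero]
      · intro h
        exact absurd (Finset.mem_range.2 (by omega)) h
      · intro k _
        by_cases hk : k ∈ S
        · rw [hroot k hk, mul_zero]
        · have : w k = 0 := by simpa [hS] using hk
          rw [this, map_zero, zero_mul, zero_mul]
    have hSu : u ≤ S.card := by
      by_contra! hlt
      have h0 := hcoeff 0 (by omega) (by omega)
      rw [coeff_zero_eq_eval_zero, hP, eval_prod, Finset.prod_eq_zero_iff] at h0
      obtain ⟨i, -, hi⟩ := h0
      rw [eval_sub, eval_X, Polynomial.eval_C, zero_sub, neg_eq_zero] at hi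
      exact pow_ne_zero _ (hb.ne_zero (Nat.succ_ne_zero q)) hi
    refine ⟨by omega, fun hdvd => ?_⟩
    by_contra! hlt
    have hcard : S.card = u := by omega
    apply hdvd
    rw [← hcard]
    -- All middle coefficients vanish, so `P = X ^ u + P.coeff 0` and its roots share one `u`-th
    -- power.
    refine card_dvd_of_pow_card_eq hb (Finset.card_pos.1 (by omega)) (a := -P.coeff 0) fun k hk => ?_
    have hev := hroot k hk
    have hlead : P.coeff u = 1 := by
      have := (monic_prod_of_monic S (fun i : Fin (q + 1) => X - Polynomial.C (b ^ (i : ℕ)))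
        fun i _ => monic_X_sub_C _).coeff_natDegree
      rwa [← hP, hdeg, hcard] at this
    rw [eval_eq_sum_range, hdeg, hcard, Finset.sum_range_succ, hlead, one_mul,
      Finset.sum_eq_single 0] at hev
    · rw [hcard]
      linear_combination hev
    · intro i hi hi0
      rw [Finset.mem_range] at hi
      rw [hcoeff i hi (by omega), zero_mul]
    · intro h
      exact absurd (Finset.mem_range.2 (by omega)) h

end ConsecutiveZeros

/-! ### Cyclic codes as multiples of a polynomial -/

section CyclicCodes

variable {F : Type*} [Field F] {n : ℕ}

theorem mem_cyclicCode {g : F[X]} {c : Fin n → F} :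
    c ∈ cyclicCode n g ↔ ∃ a d : F[X],
      ∑ i : Fin n, C (c i) * X ^ (i : ℕ) = a * g + d * (X ^ n - 1) := by
  have h : c ∈ cyclicCode n g ↔ Ideal.Quotient.mk (Ideal.span {(X ^ n - 1 : F[X])})
      (∑ i : Fin n, C (c i) * X ^ (i : ℕ)) ∈
      Ideal.span {(Ideal.Quotient.mk (Ideal.span {(X ^ n - 1 : F[X])}) g)} := Iff.rfl
  rw [h, Ideal.mem_span_singleton']
  constructor
  · rintro ⟨a, ha⟩
    obtain ⟨a, rfl⟩ := Ideal.Quotient.mk_surjective a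
    rw [← map_mul, eq_comm, Ideal.Quotient.eq, Ideal.mem_span_singleton'] at ha
    obtain ⟨d, hd⟩ := ha
    exact ⟨a, d, by rw [hd]; ring⟩
  · rintro ⟨a, d, had⟩
    refine ⟨Ideal.Quotient.mk _ a, ?_⟩
    rw [← map_mul, eq_comm, Ideal.Quotient.eq, Ideal.mem_span_singleton']
    exact ⟨d, by rw [had]; ring⟩

theorem le_finrank_cyclicCode {g : F[X]} (hg : g ≠ 0) {r : ℕ} (hr : g.natDegree + r ≤ n) :
    r ≤ Module.finrank F (cyclicCode n g) := by
  let f : degreeLT F r →ₗ[F] (Fin n → F) :=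
    (LinearMap.pi fun k : Fin n => lcoeff F (k : ℕ)).comp
      ((LinearMap.mulLeft F g).comp (degreeLT F r).subtype)
  have hf : ∀ (a : degreeLT F r) (k : Fin n), f a k = (g * a.1).coeff k := fun _ _ => rfl
  have hdeg : ∀ a : degreeLT F r, (g * a.1).degree < n := by
    intro a
    rcases eq_or_ne a.1 0 with h0 | h0
    · rw [h0, mul_zero, degree_zero]
      exact WithBot.bot_lt_coe n
    · have h1 := (natDegree_lt_iff_degree_lt h0).2 (mem_degreeLT.1 a.2)
      rw [← natDegree_lt_iff_degree_lt (mul_ne_zero hg h0), natDegree_mul hg h0]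
      omega
  have hsum : ∀ a : degreeLT F r, ∑ k : Fin n, C (f a k) * X ^ (k : ℕ) = g * a.1 := by
    intro a
    ext i
    simp only [hf, finsetSum_coeff, coeff_C_mul_X_pow]
    by_cases hi : i < n
    · rw [Finset.sum_eq_single ⟨i, hi⟩]
      · simp
      · intro k _ hk
        rw [if_neg fun h => hk (Fin.ext h.symm)]
      · simp
    · rw [coeff_eq_zero_of_degree_lt ((hdeg a).trans_le (by exact_mod_cast not_lt.1 hi))]
      exact Finset.sum_eq_zero fun k _ => if_neg fun h : i = (k : ℕ) => hi (h ▸ k.2)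
  have hinj : Function.Injective f := by
    rw [← LinearMap.ker_eq_bot, LinearMap.ker_eq_bot']
    intro a ha
    have := hsum a
    rw [ha] at this
    simp only [Pi.zero_apply, map_zero, zero_mul, Finset.sum_const_zero] at this
    exact Subtype.ext ((mul_eq_zero.1 this.symm).resolve_left hg)
  have hrange : LinearMap.range f ≤ cyclicCode n g := by
    rintro _ ⟨a, rfl⟩
    exact mem_cyclicCode.2 ⟨a.1, 0, by rw [hsum]; ring⟩
  have h1 := Submodule.finrank_mono hrange
  rwa [LinearMap.finrank_range_of_inj hinj, (degreeLTEquiv F r).finrank_eq,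
    Module.finrank_fin_fun] at h1

end CyclicCodes

/-! ### Zeros and degree of the generator polynomial -/

section GeneratorPolynomial

variable {F E : Type*} [Field F] [Field E] [Algebra F E] {q u : ℕ} {b : E}

theorem genPoly_ne_zero [Finite E] (q : ℕ) (b : E) (u : ℕ) : genPoly F q b u ≠ 0 :=
  Finset.prod_ne_zero_iff.2 fun _ _ => minpoly.ne_zero (Algebra.IsIntegral.isIntegral _)

variable [Fintype F]

theorem aeval_pow_card_eq_zero (hF : Fintype.card F = q) {y : E} {P : F[X]}
    (h : aeval y P = 0) : aeval (y ^ q) P = 0 := by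
  subst hF
  have := aeval_algHom_apply (FiniteField.frobeniusAlgHom F E) y P
  rw [h, map_zero] at this
  exact this

theorem aeval_genPoly_eq_zero (hF : Fintype.card F = q) (hb : IsPrimitiveRoot b (q + 1))
    {j : ℕ} (hj : u ≤ j) (hju : j + u ≤ q + 1) :
    aeval (b ^ j) (genPoly F q b u) = 0 := by
  rw [genPoly, map_prod, Finset.prod_eq_zero_iff]
  rcases le_or_gt j ((q + 1) / 2) with h | h
  · exact ⟨j, Finset.mem_Icc.2 ⟨hj, h⟩, minpoly.aeval _ _⟩
  · refine ⟨q + 1 - j, Finset.mem_Icc.2 ⟨by omega, by omega⟩, ?_⟩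
    have := aeval_pow_card_eq_zero hF (minpoly.aeval F (b ^ (q + 1 - j)))
    rwa [← pow_mul, mul_comm, pow_mul_eq_pow_sub hb (by omega), Nat.sub_sub_self (by omega)] at this

variable [Fintype E]

/-- The quadratic is `(X - y) * (X - y ^ q)`: trace `s` and norm `y ^ (q + 1) = 1`. -/
theorem exists_quadratic_of_pow_succ_eq_one (hF : Fintype.card F = q)
    (hE : Fintype.card E = q ^ 2) {y : E} (hy : y ^ (q + 1) = 1) :
    ∃ s : F, minpoly F y ∣ X ^ 2 - C s * X + 1 ∧
      ∀ z : E, aeval z (X ^ 2 - C s * X + 1 : F[X]) = (z - y) * (z - y ^ q) := by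
  obtain ⟨s, hs⟩ := exists_algebraMap_eq_add_pow (F := F) hF hE y
  have h : ∀ z : E, aeval z (X ^ 2 - C s * X + 1 : F[X]) = (z - y) * (z - y ^ q) := by
    intro z
    rw [pow_succ] at hy
    simp only [map_add, map_sub, map_mul, map_pow, aeval_X, aeval_C, map_one, hs]
    linear_combination -hy
  exact ⟨s, minpoly.dvd F y (by rw [h, sub_self, zero_mul]), h⟩

theorem natDegree_minpoly_le_two (hF : Fintype.card F = q) (hE : Fintype.card E = q ^ 2) {y : E}
    (hy : y ^ (q + 1) = 1) : (minpoly F y).natDegree ≤ 2 := by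
  obtain ⟨s, hs, -⟩ := exists_quadratic_of_pow_succ_eq_one (F := F) hF hE hy
  have hd : (X ^ 2 - C s * X + 1 : F[X]).natDegree = 2 := by compute_degree!
  rw [← hd]
  exact natDegree_le_of_dvd hs fun h => by rw [h, natDegree_zero] at hd; omega

theorem eq_or_eq_pow_of_aeval_minpoly (hF : Fintype.card F = q) (hE : Fintype.card E = q ^ 2)
    {y z : E} (hy : y ^ (q + 1) = 1) (hz : aeval z (minpoly F y) = 0) : z = y ∨ z = y ^ q := by
  obtain ⟨s, ⟨a, ha⟩, h⟩ := exists_quadratic_of_pow_succ_eq_one (F := F) hF hE hy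
  have h1 := h z
  rw [ha, map_mul, hz, zero_mul, eq_comm, mul_eq_zero, sub_eq_zero, sub_eq_zero] at h1
  exact h1

theorem natDegree_genPoly_le (hF : Fintype.card F = q) (hE : Fintype.card E = q ^ 2)
    (hb : IsPrimitiveRoot b (q + 1)) (hu : 2 * u ≤ q + 1) :
    (genPoly F q b u).natDegree ≤ q + 2 - 2 * u := by
  have hpow : ∀ i, (b ^ i) ^ (q + 1) = 1 := fun i => by
    rw [← pow_mul, mul_comm, pow_mul, hb.pow_eq_one, one_pow]
  rw [genPoly, natDegree_prod _ _ fun _ _ => minpoly.ne_zero (Algebra.IsIntegral.isIntegral _)]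
  rcases Nat.even_or_odd' (q + 1) with ⟨N, hN | hN⟩
  · have hN' : (q + 1) / 2 = N := by omega
    rw [hN', ← Finset.Ico_insert_right (by omega), Finset.sum_insert (by simp)]
    -- For `q + 1 = 2 * N` the middle root is `-1`, which lies in `F`; bounding this factor by `2`
    -- would overshoot by one.
    have h1 : (minpoly F (b ^ N)).natDegree ≤ 1 := by
      have hbN : b ^ N = algebraMap F E (-1) := by
        rw [map_neg, map_one]
        have h2 : (b ^ N) ^ 2 = 1 := by rw [← pow_mul, mul_comm, ← hN, hb.pow_eq_one]
        refine (eq_or_eq_neg_of_sq_eq_sq (b ^ N) 1 (by rw [h2, one_pow])).resolve_left fun h => ?_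
        have := Nat.le_of_dvd (by omega) ((hb.pow_eq_one_iff_dvd N).1 h)
        omega
      rw [hbN, minpoly.eq_X_sub_C, natDegree_X_sub_C]
    have h2 := Finset.sum_le_card_nsmul (Finset.Ico u N) (fun i => (minpoly F (b ^ i)).natDegree) 2
      fun i _ => natDegree_minpoly_le_two hF hE (hpow i)
    rw [Nat.card_Ico, smul_eq_mul] at h2
    omega
  · have hN' : (q + 1) / 2 = N := by omega
    rw [hN']
    have h2 := Finset.sum_le_card_nsmul (Finset.Icc u N) (fun i => (minpoly F (b ^ i)).natDegree) 2
      fun i _ => natDegree_minpoly_le_two hF hE (hpow i)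
    rw [Nat.card_Icc, smul_eq_mul] at h2
    omega

theorem genPoly_dvd (hF : Fintype.card F = q) (hE : Fintype.card E = q ^ 2)
    (hb : IsPrimitiveRoot b (q + 1)) (hu1 : 1 ≤ u) {P : F[X]}
    (h : ∀ j, u ≤ j → j ≤ (q + 1) / 2 → aeval (b ^ j) P = 0) : genPoly F q b u ∣ P := by
  refine Finset.prod_dvd_of_coprime ?_ fun i hi => minpoly.dvd F _ ?_
  · intro i hi j hj hij
    rw [Finset.mem_coe, Finset.mem_Icc] at hi hj
    refine ((minpoly.irreducible (Algebra.IsIntegral.isIntegral _)).coprime_iff_not_dvd).2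
      fun hdvd => ?_
    have h0 : aeval (b ^ i) (minpoly F (b ^ j)) = 0 := by
      obtain ⟨a, ha⟩ := hdvd
      beta_reduce at ha
      rw [ha, map_mul, minpoly.aeval, zero_mul]
    have hpow : (b ^ j) ^ (q + 1) = 1 := by
      rw [← pow_mul, mul_comm, pow_mul, hb.pow_eq_one, one_pow]
    rcases eq_or_eq_pow_of_aeval_minpoly hF hE hpow h0 with h1 | h1
    · exact hij (hb.pow_inj (by omega) (by omega) h1)
    · rw [← pow_mul, mul_comm j, pow_mul_eq_pow_sub hb (by omega)] at h1
      have := hb.pow_inj (by omega) (by omega) h1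
      omega
  · rw [Finset.mem_Icc] at hi
    exact h i hi.1 hi.2

theorem hasConsecutiveZeros_cyclicCode (hF : Fintype.card F = q) (hE : Fintype.card E = q ^ 2)
    (hb : IsPrimitiveRoot b (q + 1)) (hu1 : 1 ≤ u) (hu : 2 * u ≤ q + 1) :
    HasConsecutiveZeros (cyclicCode (q + 1) (genPoly F q b u)) b u := by
  intro c
  have haeval : ∀ j : ℕ, aeval (b ^ j) (∑ i : Fin (q + 1), C (c i) * X ^ (i : ℕ)) =
      ∑ k : Fin (q + 1), algebraMap F E (c k) * b ^ (j * k) := by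
    intro j
    simp [map_sum, pow_mul]
  constructor
  · intro hc j hj hju
    obtain ⟨a, d, h⟩ := mem_cyclicCode.1 hc
    have hpow : (b ^ j) ^ (q + 1) = 1 := by
      rw [← pow_mul, mul_comm, pow_mul, hb.pow_eq_one, one_pow]
    rw [← haeval, h, map_add, map_mul, aeval_genPoly_eq_zero hF hb hj (by omega)]
    simp [hpow]
  · intro h
    obtain ⟨a, ha⟩ := genPoly_dvd hF hE hb hu1 fun j hj hj' =>
      (haeval j).trans (h j hj (by omega))
    exact mem_cyclicCode.2 ⟨a, 0, by rw [ha]; ring⟩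

/-- The degree of the generator bounds the dimension below; a larger dimension would make the
Singleton bound contradict the BCH bound. -/
theorem finrank_cyclicCode_genPoly (hF : Fintype.card F = q)
    (hE : Fintype.card E = q ^ 2) (hb : IsPrimitiveRoot b (q + 1)) (hu1 : 1 ≤ u)
    (hu : 2 * u ≤ q + 1) :
    Module.finrank F (cyclicCode (q + 1) (genPoly F q b u)) = 2 * u - 1 := by
  classical
  have hC := hasConsecutiveZeros_cyclicCode hF hE hb hu1 hu
  have hdeg := natDegree_genPoly_le hF hE hb hu
  refine le_antisymm ?_ (le_finrank_cyclicCode (genPoly_ne_zero q b u) (by omega))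
  by_contra! hlt
  obtain ⟨c, hc, hc0, hle⟩ := exists_hammingNorm_le_singleton
    (cyclicCode (q + 1) (genPoly F q b u))
    (k := Module.finrank F (cyclicCode (q + 1) (genPoly F q b u)) - 1) (by omega)
  have := hC.le_hammingNorm hb hu hc hc0
  omega

end GeneratorPolynomial

/-! ### Arithmetic preliminaries and the main theorem -/

theorem isPrimitiveRoot_pow_pred {E : Type*} [Field E] [Fintype E] {q : ℕ} (hq : 1 < q)
    (hE : Fintype.card E = q ^ 2) {α : Eˣ} (hα : ∀ x : Eˣ, x ∈ Subgroup.zpowers α) :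
    IsPrimitiveRoot ((α : E) ^ (q - 1)) (q + 1) := by
  classical
  have hcard : orderOf α = (q - 1) * (q + 1) := by
    rw [orderOf_eq_card_of_forall_mem_zpowers hα, Nat.card_eq_fintype_card, Fintype.card_units, hE]
    obtain ⟨r, rfl⟩ := Nat.exists_eq_add_of_lt hq
    rw [Nat.add_sub_cancel, Nat.sub_eq_iff_eq_add (Nat.one_le_pow _ _ (by omega))]
    ring
  have h : IsPrimitiveRoot (α : E) (orderOf α) :=
    IsPrimitiveRoot.coe_units_iff.2 (IsPrimitiveRoot.orderOf α)
  refine h.pow ?_ hcard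
  rw [hcard]
  exact Nat.mul_pos (by omega) (by omega)

theorem odd_of_three_dvd_two_pow_succ {m : ℕ} (h : 3 ∣ 2 ^ m + 1) : Odd m := by
  by_contra hm
  obtain ⟨k, rfl⟩ := Nat.not_odd_iff_even.1 hm
  have : 2 ^ (k + k) % 3 = 1 := by
    rw [← two_mul, pow_mul, Nat.pow_mod]
    norm_num
  omega

end CodingTheory

theorem mainTheorem3 (p m q u : ℕ) (hp : p.Prime) (hm : 0 < m) (hq : q = p ^ m) (hq2 : 2 < q)
    (hu2 : 2 ≤ u) (hu : u ≤ (q + 1) / 2)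
    {F E : Type*} [Field F] [DecidableEq F] [Fintype F] [Field E] [Fintype E] [Algebra F E]
    (hF : Fintype.card F = q) (hE : Fintype.card E = q ^ 2)
    (α : Eˣ) (hα : ∀ x : Eˣ, x ∈ Subgroup.zpowers α) :
    (u ∣ q + 1 →
      CodingTheory.IsCode (q + 2) (2 * u - 1) (q + 3 - 2 * u)
        (CodingTheory.extendedCode (CodingTheory.classicalMDSCode F q (α : E) u)) ∧
      CodingTheory.IsCode (q + 2) (q + 3 - 2 * u) (u + 1)
        (CodingTheory.dualCode
          (CodingTheory.extendedCode (CodingTheory.classicalMDSCode F q (α : E) u)))) ∧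
    (¬ u ∣ q + 1 → u + 1 ∣ q + 1 →
      CodingTheory.IsCode (q + 2) (2 * u - 1)
        (if u = 2 ∧ p = 2 ∧ Odd m then q + 4 - 2 * u else q + 3 - 2 * u)
        (CodingTheory.extendedCode (CodingTheory.classicalMDSCode F q (α : E) u)) ∧
      CodingTheory.IsCode (q + 2) (q + 3 - 2 * u) (u + 2)
        (CodingTheory.dualCode
          (CodingTheory.extendedCode (CodingTheory.classicalMDSCode F q (α : E) u)))) := by
  have hb := CodingTheory.isPrimitiveRoot_pow_pred (by omega) hE hα
  have hu' : 2 * u ≤ q + 1 := by omega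
  have hq0 : (q : E) = 0 := CodingTheory.cast_card_eq_zero_of_algebra hF
  have hC := CodingTheory.hasConsecutiveZeros_cyclicCode hF hE hb (by omega) hu'
  have hdim : Module.finrank F (CodingTheory.extendedCode
      (CodingTheory.classicalMDSCode F q (α : E) u)) = 2 * u - 1 := by
    rw [CodingTheory.finrank_extendedCode]
    exact CodingTheory.finrank_cyclicCode_genPoly hF hE hb (by omega) hu'
  have hdual : Module.finrank F (CodingTheory.dualCode (CodingTheory.extendedCode
      (CodingTheory.classicalMDSCode F q (α : E) u))) = q + 3 - 2 * u := by
    rw [CodingTheory.finrank_dualCode, hdim]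
    omega
  have hle := fun c hc hc0 => hC.le_hammingNorm_extendedCode hb hu' (c := c) hc hc0
  have hledual := fun x hx hx0 => hC.le_hammingNorm_dual hb hq2 hu2 hu' hF hE (x := x) hx hx0
  refine ⟨fun hdvd => ?_, fun hndvd hdvd => ?_⟩
  · obtain ⟨x, hx, hx0, hxw⟩ := hC.exists_dual_of_dvd hb hq0 hdvd le_rfl
    refine ⟨CodingTheory.isCode_of hdim ?_ hle,
      CodingTheory.isCode_of hdual ⟨x, hx, hx0, hxw⟩ fun y hy hy0 => (hledual y hy hy0).1⟩
    obtain ⟨c, hc, hc0, hcw⟩ :=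
      CodingTheory.exists_hammingNorm_le_of_dual _ hdim hx hx0 (by omega)
    exact ⟨c, hc, hc0, by omega⟩
  · obtain ⟨x, hx, hx0, hxw⟩ := hC.exists_dual_of_dvd hb hq0 hdvd (Nat.le_succ u)
    refine ⟨?_, CodingTheory.isCode_of hdual ⟨x, hx, hx0, hxw⟩
      fun y hy hy0 => (hledual y hy hy0).2 hndvd⟩
    -- Transferring the dual word of weight `u + 2` needs `u + 2 ≤ 2 * u - 1`, which fails exactly
    -- at `u = 2`. There the dual has no nonzero word of weight at most `3`, the dimension of the
    -- code, so the extended code is itself MDS.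
    rcases hu2.eq_or_lt with rfl | hu3
    · have hp2 : p = 2 := by
        by_contra hp2
        have hodd : Odd q := hq ▸ (hp.odd_of_ne_two hp2).pow
        exact hndvd hodd.add_one.two_dvd
      have hmodd : Odd m := by
        subst hp2
        exact CodingTheory.odd_of_three_dvd_two_pow_succ (hq ▸ hdvd)
      rw [if_pos ⟨rfl, hp2, hmodd⟩]
      refine CodingTheory.isCode_of hdim ?_ fun c hc hc0 => ?_
      · obtain ⟨c, hc, hc0, hcw⟩ := CodingTheory.exists_hammingNorm_le_singleton _ hdim
        exact ⟨c, hc, hc0, by omega⟩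
      · by_contra! hlt
        obtain ⟨y, hy, hy0, hyw⟩ := CodingTheory.exists_dual_hammingNorm_le _ hdim hc hc0 (by omega)
        have := (hledual y hy hy0).2 hndvd
        omega
    · rw [if_neg fun h => hu3.ne' h.1]
      refine CodingTheory.isCode_of hdim ?_ hle
      obtain ⟨c, hc, hc0, hcw⟩ :=
        CodingTheory.exists_hammingNorm_le_of_dual _ hdim hx hx0 (by omega)
      exact ⟨c, hc, hc0, by omega⟩
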